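/- Let $X$ be a finite set and let $(X,\{R_0,\dots,R_D\})$ be a symmetric association scheme of class $D\ge 2$ with adjacency matrices $A_0=I,A_1,\dots,A_D$. Suppose that it is $Q$-polynomial with respect to the ordering $E_0=\frac1{|X|}J,E_1,\dots,E_D$ of its primitive idempotents; that is, for each $0\le i\le D$ there is a real polynomial $v_i^*$ of degree $i$ such that $|X|E_i$ is obtained by applying $v_i^*$ to each entry of $|X|E_1$. Define the dual eigenvalues $\theta_h^*$ by $E_1=\frac1{|X|}\sum_{h=0}^D\theta_h^*A_h$ and the Krein parameters $q_{i,j}^h$ by $E_i\circ E_j=\frac1{|X|}\sum_{h=0}^D q_{i,j}^hE_h$, where $\circ$ is the entrywise product, and put $m=\theta_0^*$, $b_i^*=q_{1,i+1}^i$ $(0\le i\le D-1)$ and $c_i^*=q_{1,i-1}^i$ $(1\le i\le D)$. Label the relations so that $\theta_0^*\ge\theta_1^*\ge\dots\ge\theta_D^*$. Then the dual eigenvalues are distinct, $m=\theta_0^*>\theta_1^*>\dots>\theta_D^*$, and the following hold. 1. $(\theta_1^*+1)(\theta_D^*+1)\le -b_1^*$, with equality if and only if $D=2$. 2. Assume $D\ge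 3$. - If $b_2^*+c_3^*\ge m+1$, then $(\theta_1^*+1)(\theta_{D-1}^*+1)(\theta_D^*+1)\ge -b_1^*(m+1-b_2^*-c_3^*)$. - If $b_2^*+c_3^*\le m+1$, then $(\theta_1^*+1)(\theta_2^*+1)(\theta_D^*+1)\le -b_1^*(m+1-b_2^*-c_3^*)$. In either case equality holds if and only if $D=3$. -/

import Mathlib

open Matrix

/-- A symmetric association scheme of class `D` on the finite set `X`. The partition of `X × X`
into the relations `R_0, …, R_D` is given by the map that sends a pair to the index of its
relation. -/
structure AssociationScheme (X : Type*) [Fintype X] (D : ℕ) where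
  /-- `rel x y` is the index `i` with `(x, y) ∈ R_i` -/
  rel : X → X → Fin (D + 1)
  /-- every relation is non-empty -/
  rel_surj : ∀ i, ∃ x y, rel x y = i
  /-- `R_0` is the diagonal -/
  rel_eq_zero_iff : ∀ x y, rel x y = 0 ↔ x = y
  /-- every relation is symmetric -/
  rel_symm : ∀ x y, rel x y = rel y x
  /-- the intersection numbers `p_{i,j}^k` exist -/
  intersection : ∀ i j k : Fin (D + 1), ∃ p : ℕ, ∀ x y, rel x y = k →
    (Finset.univ.filter fun z => rel x z = i ∧ rel z y = j).card = p

namespace AssociationScheme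

variable {X : Type*} [Fintype X] {D : ℕ} (S : AssociationScheme X D)

/-- The adjacency matrix `A_i` of the relation `R_i`. -/
def adj (i : Fin (D + 1)) : Matrix X X ℝ :=
  Matrix.of fun x y => if S.rel x y = i then 1 else 0

/-- The Bose–Mesner algebra, as a space of matrices: the span of `A_0, …, A_D`. -/
def boseMesner : Submodule ℝ (Matrix X X ℝ) :=
  Submodule.span ℝ (Set.range S.adj)

/-- `E_0, …, E_D` are the primitive idempotents of the scheme: the non-zero, mutually orthogonal
idempotents of the Bose–Mesner algebra that sum to the identity, with `E_0 = |X|⁻¹ J`. (There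
are `D + 1` of them, so they form a basis of the algebra.) -/
structure IsPrimitiveIdempotents [DecidableEq X] (E : Fin (D + 1) → Matrix X X ℝ) : Prop where
  zero : E 0 = (1 / (Fintype.card X : ℝ)) • Matrix.of fun _ _ => 1
  mem : ∀ i, E i ∈ S.boseMesner
  ne_zero : ∀ i, E i ≠ 0
  idem : ∀ i, E i * E i = E i
  orthogonal : ∀ i j, i ≠ j → E i * E j = 0
  sum_eq_one : ∑ i, E i = 1

/-- The scheme is `Q`-polynomial with respect to the ordering `E_0, …, E_D` of its primitive
idempotents: for each `i` there is a real polynomial `v` of degree `i` such that `|X| E_i` is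
obtained by applying `v` to every entry of `|X| E_1`. -/
def IsPrimitiveIdempotents.IsQPolynomial [DecidableEq X] {S : AssociationScheme X D}
    {E : Fin (D + 1) → Matrix X X ℝ} (_hE : S.IsPrimitiveIdempotents E) : Prop :=
  ∀ i : Fin (D + 1), ∃ v : Polynomial ℝ, v.degree = ((i : ℕ) : WithBot ℕ) ∧
    ∀ x y, (Fintype.card X : ℝ) * E i x y = v.eval ((Fintype.card X : ℝ) * E 1 x y)

variable {S}

theorem card_ne_zero (S : AssociationScheme X D) : (Fintype.card X : ℝ) ≠ 0 := by
  obtain ⟨x, -, -⟩ := S.rel_surj 0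
  have : Nonempty X := ⟨x⟩
  exact_mod_cast Fintype.card_ne_zero

theorem mem_boseMesner_iff (M : Matrix X X ℝ) :
    M ∈ S.boseMesner ↔ ∃ f : Fin (D + 1) → ℝ, ∀ x y, M x y = f (S.rel x y) := by
  unfold boseMesner
  rw [Submodule.mem_span_range_iff_exists_fun]
  constructor
  · rintro ⟨c, rfl⟩
    exact ⟨c, fun x y => by simp [Matrix.sum_apply, adj]⟩
  · rintro ⟨f, hf⟩
    exact ⟨f, by ext x y; simp [Matrix.sum_apply, adj, hf]⟩

theorem hadamard_mem {M N : Matrix X X ℝ} (hM : M ∈ S.boseMesner) (hN : N ∈ S.boseMesner) :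
    M ⊙ N ∈ S.boseMesner := by
  rw [mem_boseMesner_iff] at *
  obtain ⟨f, hf⟩ := hM
  obtain ⟨g, hg⟩ := hN
  exact ⟨fun i => f i * g i, fun x y => by simp [hf, hg]⟩

section

variable [DecidableEq X] {E : Fin (D + 1) → Matrix X X ℝ}

theorem IsPrimitiveIdempotents.linearIndependent (hE : S.IsPrimitiveIdempotents E) :
    LinearIndependent ℝ E := by
  rw [Fintype.linearIndependent_iff]
  intro g hg i
  have h : (∑ j, g j • E j) * E i = g i • E i := by
    rw [Finset.sum_mul, Finset.sum_eq_single i]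
    · rw [Matrix.smul_mul, hE.idem]
    · intro j _ hj
      rw [Matrix.smul_mul, hE.orthogonal j i hj, smul_zero]
    · simp
  rw [hg, zero_mul] at h
  exact (smul_eq_zero.mp h.symm).resolve_right (hE.ne_zero i)

theorem IsPrimitiveIdempotents.span_eq (hE : S.IsPrimitiveIdempotents E) :
    Submodule.span ℝ (Set.range E) = S.boseMesner := by
  apply Submodule.eq_of_le_of_finrank_le
  · rw [Submodule.span_le]
    rintro _ ⟨i, rfl⟩
    exact hE.mem i
  · rw [finrank_span_eq_card hE.linearIndependent]
    exact finrank_range_le_card S.adj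

theorem IsPrimitiveIdempotents.exists_krein (hE : S.IsPrimitiveIdempotents E)
    (i j : Fin (D + 1)) : ∃ q : Fin (D + 1) → ℝ,
      E i ⊙ E j = (1 / (Fintype.card X : ℝ)) • ∑ h, q h • E h := by
  have h := hadamard_mem (hE.mem i) (hE.mem j)
  rw [← hE.span_eq, Submodule.mem_span_range_iff_exists_fun] at h
  obtain ⟨c, hc⟩ := h
  refine ⟨fun h => (Fintype.card X : ℝ) * c h, ?_⟩
  simp only [mul_smul, ← Finset.smul_sum]
  rw [hc, smul_smul, one_div, inv_mul_cancel₀ S.card_ne_zero, one_smul]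

theorem IsPrimitiveIdempotents.exists_dualEigenvalue (hE : S.IsPrimitiveIdempotents E) :
    ∃ θ : Fin (D + 1) → ℝ, E 1 = (1 / (Fintype.card X : ℝ)) • ∑ h, θ h • S.adj h := by
  have h := hE.mem 1
  rw [boseMesner, Submodule.mem_span_range_iff_exists_fun] at h
  obtain ⟨c, hc⟩ := h
  refine ⟨fun h => (Fintype.card X : ℝ) * c h, ?_⟩
  simp only [mul_smul, ← Finset.smul_sum]
  rw [hc, smul_smul, one_div, inv_mul_cancel₀ S.card_ne_zero, one_smul]

/-- The Krein parameter `q_{i,j}^h`: the (unique) coefficients in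
`E_i ∘ E_j = |X|⁻¹ ∑_h q_{i,j}^h E_h`, where `∘` is the entrywise product. -/
noncomputable def IsPrimitiveIdempotents.krein (hE : S.IsPrimitiveIdempotents E)
    (i j h : Fin (D + 1)) : ℝ :=
  (hE.exists_krein i j).choose h

theorem IsPrimitiveIdempotents.krein_spec (hE : S.IsPrimitiveIdempotents E)
    (i j : Fin (D + 1)) :
    E i ⊙ E j = (1 / (Fintype.card X : ℝ)) • ∑ h, hE.krein i j h • E h :=
  (hE.exists_krein i j).choose_spec

/-- The dual eigenvalue `θ*_h`: the (unique) coefficients in `E_1 = |X|⁻¹ ∑_h θ*_h A_h`. -/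
noncomputable def IsPrimitiveIdempotents.dualEigenvalue (hE : S.IsPrimitiveIdempotents E)
    (h : Fin (D + 1)) : ℝ :=
  hE.exists_dualEigenvalue.choose h

theorem IsPrimitiveIdempotents.dualEigenvalue_spec (hE : S.IsPrimitiveIdempotents E) :
    E 1 = (1 / (Fintype.card X : ℝ)) • ∑ h, hE.dualEigenvalue h • S.adj h :=
  hE.exists_dualEigenvalue.choose_spec

/-- `b*_i = q_{1,i+1}^i` for `0 ≤ i ≤ D - 1`. -/
noncomputable def IsPrimitiveIdempotents.bStar (hE : S.IsPrimitiveIdempotents E)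
    (i : ℕ) (hi : i + 1 ≤ D) : ℝ :=
  hE.krein 1 ⟨i + 1, by omega⟩ ⟨i, by omega⟩

/-- `c*_i = q_{1,i-1}^i` for `1 ≤ i ≤ D`. -/
noncomputable def IsPrimitiveIdempotents.cStar (hE : S.IsPrimitiveIdempotents E)
    (i : ℕ) (hi : 1 ≤ i ∧ i ≤ D) : ℝ :=
  hE.krein 1 ⟨i - 1, by omega⟩ ⟨i, by omega⟩

end

end AssociationScheme

/-! Put t_h = θ*_h + 1 and give h the weight |R_h| (θ*_0 − θ*_h). This vanishes at h = 0 and is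
positive for h ≥ 1, so it is a positive measure on θ*_1, …, θ*_D. The polynomials v*_i are
orthogonal for the weights |R_h|, so by the Christoffel kernel formula the partial sums u_i = v*_0 +
⋯ + v*_i are orthogonal for the new measure. Here u_1 = t and, up to positive factors, u_2 is t² − a
t − b*_1 and u_3 is (t − c)(t² − a t − b*_1) − c*_2 b*_2 t with c = m + 1 − b*_2 − c*_3. The roots
r_1 > r_2 > r_3 of u_3 have product −b*_1 c. The moments used are in `sum_weight_mul` and
`sum_weight_mul_cubic`.

Claim 1 integrates (t_1 − t)(t − t_D) ≥ 0. For claim 2 with c ≥ 0, testing u_3 against quadratics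
built from its roots gives r_1 ≤ t_1, r_2 ≤ t_2 and t_D ≤ r_3; the sign of c makes r_2 ≥ 0, so the
products compare (`mul_three_nodes_le`). The case c ≤ 0 follows by reflection. Equality holds
exactly when no further nodes exist. The Krein condition supplies b*_i, c*_i > 0, which makes the
roots of u_3 real and distinct with r_3 < 0 < r_1. -/

/-! ### Nodes of a discrete measure against roots of its orthogonal polynomials. -/

/-- A quadratic with orthogonality relations against a positive discrete measure: the product of
the extreme nodes is at most the product of the roots. -/
theorem mul_extreme_nodes_le {ι : Type*} (s : Finset ι) (w t : ι → ℝ) (hw : ∀ i ∈ s, 0 < w i)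
    {i₁ i₃ : ι} (h₁ : i₁ ∈ s)
    (hmid : ∀ i ∈ s, i ≠ i₁ → i ≠ i₃ → t i₃ < t i ∧ t i < t i₁)
    {b : ℝ} (hw1 : ∑ i ∈ s, w i * t i = 0) (hw2 : ∑ i ∈ s, w i * t i ^ 2 = b * ∑ i ∈ s, w i) :
    t i₁ * t i₃ ≤ -b ∧ (t i₁ * t i₃ = -b ↔ ∀ i ∈ s, i = i₁ ∨ i = i₃) := by
  have hpos : 0 < ∑ i ∈ s, w i := Finset.sum_pos hw ⟨i₁, h₁⟩
  -- The integrand is nonnegative at every node and vanishes only at the two extreme ones; the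
  -- moments evaluate its integral.
  have key : ∑ i ∈ s, w i * ((t i₁ - t i) * (t i - t i₃)) =
      -(t i₁ * t i₃ + b) * ∑ i ∈ s, w i := by
    have : ∀ i ∈ s, w i * ((t i₁ - t i) * (t i - t i₃)) =
        (t i₁ + t i₃) * (w i * t i) - w i * t i ^ 2 - t i₁ * t i₃ * w i := fun i _ => by ring
    rw [Finset.sum_congr rfl this, Finset.sum_sub_distrib, Finset.sum_sub_distrib,
      ← Finset.mul_sum, ← Finset.mul_sum, hw1, hw2]
    ring
  have hnn : ∀ i ∈ s, 0 ≤ w i * ((t i₁ - t i) * (t i - t i₃)) := by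
    intro i hi
    by_cases e1 : i = i₁
    · simp [e1]
    by_cases e3 : i = i₃
    · simp [e3]
    obtain ⟨ha, hb⟩ := hmid i hi e1 e3
    have := hw i hi
    have := sub_pos.2 ha
    have := sub_pos.2 hb
    positivity
  have hle := Finset.sum_nonneg hnn
  rw [key] at hle
  refine ⟨by nlinarith, fun he i hi => ?_, fun hall => ?_⟩
  · rw [he] at key
    simp only [neg_add_cancel, neg_zero, zero_mul] at key
    by_contra hne
    push Not at hne
    obtain ⟨ha, hb⟩ := hmid i hi hne.1 hne.2
    have h0 := (Finset.sum_eq_zero_iff_of_nonneg hnn).1 key i hi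
    have := hw i hi
    have := sub_pos.2 ha
    have := sub_pos.2 hb
    have : 0 < w i * ((t i₁ - t i) * (t i - t i₃)) := by positivity
    linarith
  · have : ∑ i ∈ s, w i * ((t i₁ - t i) * (t i - t i₃)) = 0 := by
      refine Finset.sum_eq_zero fun i hi => ?_
      rcases hall i hi with rfl | rfl <;> simp
    rw [key] at this
    have := (mul_eq_zero.1 this).resolve_right hpos.ne'
    linarith

/-- The roots of a cubic given by a step of a three-term recurrence are real and interlace. -/
theorem exists_roots_of_recurrence {a b c β : ℝ} (hb : 0 < b) (hβ : 0 < β) :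
    ∃ r₁ r₂ r₃ : ℝ, r₃ < r₂ ∧ r₂ < r₁ ∧ r₃ < 0 ∧ 0 < r₁ ∧
      ∀ x, (x - c) * (x ^ 2 - a * x - b) - β * x = (x - r₁) * (x - r₂) * (x - r₃) := by
  have quad : ∀ u v : ℝ, ∀ y, y ^ 2 - u * y - v < 0 → ∃ p q : ℝ,
      (∀ x, x ^ 2 - u * x - v = (x - p) * (x - q)) ∧
      ∀ x, x ^ 2 - u * x - v < 0 → q < x ∧ x < p := by
    intro u v y hy
    have hd : 0 < u ^ 2 + 4 * v := by nlinarith [sq_nonneg (2 * y - u)]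
    have hs := Real.sq_sqrt hd.le
    have hs0 := Real.sqrt_pos.2 hd
    have hf : ∀ x, x ^ 2 - u * x - v =
        (x - (u + √(u ^ 2 + 4 * v)) / 2) * (x - (u - √(u ^ 2 + 4 * v)) / 2) := by
      intro x
      linear_combination (1 / 4) * hs
    refine ⟨_, _, hf, fun x hx => ?_⟩
    rw [hf] at hx
    constructor <;> by_contra! hcon <;> nlinarith
  obtain ⟨p, q, hpq, hin⟩ := quad a b 0 (by simpa using hb)
  obtain ⟨hq0, hp0⟩ := hin 0 (by simpa using hb)
  set P : ℝ → ℝ := fun x => (x - c) * (x ^ 2 - a * x - b) - β * x with hP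
  -- At the roots q < 0 < p of the quadratic factor the cubic reduces to −βx, so its signs there are
  -- known.
  have hPq : 0 < P q := by simp only [hP, hpq]; nlinarith
  have hPp : P p < 0 := by simp only [hP, hpq]; nlinarith
  obtain ⟨r, ⟨hqr, hrp⟩, hr⟩ : (0 : ℝ) ∈ P '' Set.Ioo q p :=
    intermediate_value_Ioo' (hq0.trans hp0).le (by fun_prop) ⟨hPp, hPq⟩
  have hfac : ∀ x, P x = (x - r) * (x ^ 2 - (a + c - r) * x - (b + β - a * c + (a + c - r) * r)) := by
    intro x
    have : P x = P x - P r := by rw [hr, sub_zero]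
    rw [this]
    simp only [hP]
    ring
  rw [hfac] at hPq hPp
  -- The cofactor of x − r is negative at both p and q, so its two roots lie on either side of [q,
  -- p].
  have h1 : p ^ 2 - (a + c - r) * p - (b + β - a * c + (a + c - r) * r) < 0 := by
    by_contra! hcon
    nlinarith [mul_nonneg (sub_pos.2 hrp).le hcon]
  have h2 : q ^ 2 - (a + c - r) * q - (b + β - a * c + (a + c - r) * r) < 0 := by
    by_contra! hcon
    nlinarith [mul_nonneg (sub_pos.2 hqr).le hcon]
  obtain ⟨r₁, r₃, hroot, hin'⟩ := quad _ _ p h1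
  obtain ⟨_, hp1⟩ := hin' p h1
  obtain ⟨hq3, _⟩ := hin' q h2
  refine ⟨r₁, r, r₃, by linarith, by linarith, by linarith, by linarith, fun x => ?_⟩
  have := hfac x
  rw [hroot] at this
  simp only [hP] at this
  rw [this]
  ring

/-- The product of the two largest nodes and the least node of a positive discrete measure,
compared with the product of the roots of its orthogonal polynomial of degree three. -/
theorem mul_three_nodes_le {ι : Type*} (s : Finset ι) (w t : ι → ℝ) (hw : ∀ i ∈ s, 0 < w i)
    {i₁ i₂ i₃ : ι} (m₁ : i₁ ∈ s) (m₂ : i₂ ∈ s) (m₃ : i₃ ∈ s)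
    (h21 : t i₂ < t i₁) (h32 : t i₃ < t i₂)
    (hmid : ∀ i ∈ s, i ≠ i₁ → i ≠ i₂ → i ≠ i₃ → t i₃ < t i ∧ t i < t i₂)
    {a b c β : ℝ} (hb : 0 < b) (hβ : 0 < β) (hc : 0 ≤ c)
    (ho : ∀ x y z : ℝ, ∑ i ∈ s, w i * (((t i - c) * (t i ^ 2 - a * t i - b) - β * t i) *
      (x + y * t i + z * t i ^ 2)) = 0) :
    t i₁ * t i₂ * t i₃ ≤ -b * c ∧
      (t i₁ * t i₂ * t i₃ = -b * c ↔ ∀ i ∈ s, i = i₁ ∨ i = i₂ ∨ i = i₃) := by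
  obtain ⟨r₁, r₂, r₃, hr32, hr21, hr3, hr1, hP⟩ :=
    exists_roots_of_recurrence (a := a) (c := c) hb hβ
  have hprod : r₁ * r₂ * r₃ = -b * c := by linear_combination hP 0
  simp only [hP] at ho
  -- integrating against a product of two linear factors gives zero
  have ho' : ∀ p q : ℝ, ∑ i ∈ s, w i * ((t i - r₁) * (t i - r₂) * (t i - r₃) *
      ((t i - p) * (t i - q))) = 0 := by
    intro p q
    rw [← ho (p * q) (-(p + q)) 1]
    exact Finset.sum_congr rfl fun i _ => by ring
  -- Otherwise r₁r₂r₃ > 0, against r₁r₂r₃ = −bc ≤ 0.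
  have hr2 : 0 ≤ r₂ := by
    by_contra! hneg
    have : 0 < r₁ * r₂ * r₃ := mul_pos_of_neg_of_neg (mul_neg_of_pos_of_neg hr1 hneg) hr3
    nlinarith
  have vanish : ∀ f : ι → ℝ, (∀ i ∈ s, 0 ≤ f i) → ∑ i ∈ s, w i * f i = 0 → ∀ i ∈ s, f i = 0 := by
    intro f hf h0 i hi
    have := (Finset.sum_eq_zero_iff_of_nonneg
      (fun j hj => mul_nonneg (hw j hj).le (hf j hj))).1 h0 i hi
    exact (mul_eq_zero.1 this).resolve_left (hw i hi).ne'
  have hle1 : ∀ i ∈ s, t i ≤ t i₁ := by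
    intro i hi
    by_cases e1 : i = i₁; · rw [e1]
    by_cases e2 : i = i₂; · rw [e2]; exact h21.le
    by_cases e3 : i = i₃; · rw [e3]; linarith
    linarith [hmid i hi e1 e2 e3]
  have hge3 : ∀ i ∈ s, t i₃ ≤ t i := by
    intro i hi
    by_cases e1 : i = i₁; · rw [e1]; linarith
    by_cases e2 : i = i₂; · rw [e2]; exact h32.le
    by_cases e3 : i = i₃; · rw [e3]
    linarith [hmid i hi e1 e2 e3]
  have neg_sum : ∀ f : ι → ℝ, ∑ i ∈ s, w i * f i = 0 → ∑ i ∈ s, w i * -f i = 0 := by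
    intro f hf
    simp [mul_neg, Finset.sum_neg_distrib, hf]
  have hb1 : r₁ ≤ t i₁ := by
    by_contra! hlt
    -- Testing against (t − r₂)(t − r₃) leaves (r₁ − t) times a square; if r₁ exceeded every node,
    -- all nodes would lie in {r₂, r₃}, too few for three distinct ones.
    have hz := vanish _ (fun i hi => ?_) (neg_sum _ (ho' r₂ r₃))
    · have ne1 : ∀ i ∈ s, t i = r₂ ∨ t i = r₃ := by
        intro i hi
        have h := hz i hi
        have h1 : t i - r₁ ≠ 0 := (show t i - r₁ < 0 by linarith [hle1 i hi]).ne
        have : (t i - r₁) * ((t i - r₂) * (t i - r₃)) ^ 2 = 0 := by linear_combination -h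
        have := pow_eq_zero_iff (two_ne_zero) |>.1 ((mul_eq_zero.1 this).resolve_left h1)
        rcases mul_eq_zero.1 this with h | h
        · left; linarith
        · right; linarith
      rcases ne1 _ m₁ with e1 | e1 <;> rcases ne1 _ m₂ with e2 | e2 <;>
        rcases ne1 _ m₃ with e3 | e3 <;> linarith
    · have : 0 ≤ (r₁ - t i) * ((t i - r₂) * (t i - r₃)) ^ 2 :=
        mul_nonneg (by linarith [hle1 i hi]) (sq_nonneg _)
      linarith
  have hb3 : t i₃ ≤ r₃ := by
    by_contra! hlt
    have hz := vanish _ (fun i hi => ?_) (ho' r₁ r₂)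
    · have ne1 : ∀ i ∈ s, t i = r₁ ∨ t i = r₂ := by
        intro i hi
        have h := hz i hi
        have h1 : t i - r₃ ≠ 0 := (show 0 < t i - r₃ by linarith [hge3 i hi]).ne'
        have : (t i - r₃) * ((t i - r₁) * (t i - r₂)) ^ 2 = 0 := by linear_combination h
        have := pow_eq_zero_iff (two_ne_zero) |>.1 ((mul_eq_zero.1 this).resolve_left h1)
        rcases mul_eq_zero.1 this with h | h
        · left; linarith
        · right; linarith
      rcases ne1 _ m₁ with e1 | e1 <;> rcases ne1 _ m₂ with e2 | e2 <;>
        rcases ne1 _ m₃ with e3 | e3 <;> linarith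
    · have : 0 ≤ (t i - r₃) * ((t i - r₁) * (t i - r₂)) ^ 2 :=
        mul_nonneg (by linarith [hge3 i hi]) (sq_nonneg _)
      linarith
  -- if the second node does not exceed the second root, all further nodes are accounted for
  have second : t i₂ ≤ r₂ → ∀ i ∈ s, i = i₁ ∨ t i = r₂ ∨ t i = r₃ := by
    intro hle
    -- The factor t − t i₁ removes the largest node, the only one that may exceed r₂; on the rest
    -- the integrand has constant sign.
    have hz := vanish _ (fun i hi => ?_) (neg_sum _ (ho' r₃ (t i₁)))
    · intro i hi
      by_cases e1 : i = i₁
      · exact Or.inl e1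
      have hi2 : t i ≤ t i₂ := by
        by_cases e2 : i = i₂; · rw [e2]
        by_cases e3 : i = i₃; · rw [e3]; exact h32.le
        linarith [hmid i hi e1 e2 e3]
      have h := hz i hi
      have h1 : (t i - r₁) * (t i - t i₁) ≠ 0 :=
        (mul_pos_of_neg_of_neg (by linarith) (by linarith)).ne'
      have : (t i - r₁) * (t i - t i₁) * ((t i - r₂) * (t i - r₃) ^ 2) = 0 := by
        linear_combination -h
      rcases mul_eq_zero.1 ((mul_eq_zero.1 this).resolve_left h1) with h | h
      · right; left; linarith
      · right; right; linarith [pow_eq_zero_iff (two_ne_zero) |>.1 h]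
    · by_cases e1 : i = i₁
      · simp [e1]
      have hi2 : t i ≤ t i₂ := by
        by_cases e2 : i = i₂; · rw [e2]
        by_cases e3 : i = i₃; · rw [e3]; exact h32.le
        linarith [hmid i hi e1 e2 e3]
      have : 0 ≤ (r₁ - t i) * (t i₁ - t i) * ((r₂ - t i) * (t i - r₃) ^ 2) :=
        mul_nonneg (mul_nonneg (by linarith) (by linarith))
          (mul_nonneg (by linarith) (sq_nonneg _))
      linarith
  have hb2 : r₂ ≤ t i₂ := by
    by_contra! hlt
    have h2 := second hlt.le i₂ m₂
    have h3 := second hlt.le i₃ m₃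
    have n2 : i₂ ≠ i₁ := fun h => by rw [h] at h21; exact lt_irrefl _ h21
    have n3 : i₃ ≠ i₁ := fun h => by rw [h] at h32; linarith
    rcases h2.resolve_left n2 with e | e <;> rcases h3.resolve_left n3 with e' | e' <;> linarith
  have hle : t i₁ * t i₂ * -t i₃ ≥ r₁ * r₂ * -r₃ := by
    have : 0 ≤ r₁ * r₂ := mul_nonneg hr1.le hr2
    have hm : r₁ * r₂ ≤ t i₁ * t i₂ := mul_le_mul hb1 hb2 hr2 (by linarith)
    exact mul_le_mul hm (by linarith) (by linarith) (by linarith)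
  refine ⟨by linarith, fun he => ?_, fun hall => ?_⟩
  -- Since r₃ < 0 < r₁, a strict gap at the second node would make the product inequality strict.
  · have h2 : t i₂ ≤ r₂ := by
      by_contra! hlt
      have hm : r₁ * r₂ < t i₁ * t i₂ :=
        lt_of_le_of_lt (mul_le_mul_of_nonneg_right hb1 hr2)
          (mul_lt_mul_of_pos_left hlt (by linarith))
      have h0 : 0 ≤ r₁ * r₂ := mul_nonneg hr1.le hr2
      have : r₁ * r₂ * -r₃ < t i₁ * t i₂ * -t i₃ := by
        calc r₁ * r₂ * -r₃ < t i₁ * t i₂ * -r₃ := mul_lt_mul_of_pos_right hm (by linarith)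
          _ ≤ _ := mul_le_mul_of_nonneg_left (by linarith) (by linarith)
      linarith
    intro i hi
    by_contra! hne
    obtain ⟨hlo, hhi⟩ := hmid i hi hne.1 hne.2.1 hne.2.2
    have n3 : i₃ ≠ i₁ := fun h => by rw [h] at h32; linarith
    rcases (second h2 i hi).resolve_left hne.1 with e | e <;>
      rcases (second h2 i₃ m₃).resolve_left n3 with e' | e' <;> linarith
  -- With three nodes, the test quadratic vanishing at two of them isolates the third, so every node
  -- is a root; the order then matches them up.
  · have single : ∀ j ∈ s, ∀ p q : ℝ, (∀ i ∈ s, i ≠ j → t i = p ∨ t i = q) → t j ≠ p → t j ≠ q →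
        (t j - r₁) * (t j - r₂) * (t j - r₃) = 0 := by
      intro j hj p q hi hp hq
      have h := ho' p q
      rw [Finset.sum_eq_single_of_mem j hj] at h
      · have h' := (mul_eq_zero.1 h).resolve_left (hw j hj).ne'
        exact (mul_eq_zero.1 h').resolve_right
          (mul_ne_zero (sub_ne_zero.2 hp) (sub_ne_zero.2 hq))
      · intro i his hij
        rcases hi i his hij with e | e <;> simp [e]
    have z1 := single i₁ m₁ (t i₂) (t i₃) (fun i hi hne => by
      rcases hall i hi with rfl | rfl | rfl
      exacts [absurd rfl hne, Or.inl rfl, Or.inr rfl]) h21.ne' (h32.trans h21).ne'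
    have z2 := single i₂ m₂ (t i₁) (t i₃) (fun i hi hne => by
      rcases hall i hi with rfl | rfl | rfl
      exacts [Or.inl rfl, absurd rfl hne, Or.inr rfl]) h21.ne h32.ne'
    have z3 := single i₃ m₃ (t i₁) (t i₂) (fun i hi hne => by
      rcases hall i hi with rfl | rfl | rfl
      exacts [Or.inl rfl, Or.inr rfl, absurd rfl hne]) (h32.trans h21).ne h32.ne
    simp only [mul_eq_zero, sub_eq_zero, or_assoc] at z1 z2 z3
    have e3 : t i₃ = r₃ := by
      rcases z3 with h | h | h <;> linarith
    have e1 : t i₁ = r₁ := by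
      rcases z1 with h | h | h <;> linarith
    have e2 : t i₂ = r₂ := by
      rcases z2 with h | h | h <;> linarith
    rw [e1, e2, e3, hprod]

theorem sum_three_consecutive {D : ℕ} {f : Fin (D + 1) → ℝ} (i j l : Fin (D + 1)) (hij : (j : ℕ) = i + 1)
    (hjl : (l : ℕ) = j + 1) (hf : ∀ p : Fin (D + 1), (p : ℕ) + 1 < j ∨ (j : ℕ) + 1 < p → f p = 0) :
    ∑ p, f p = f i + f j + f l := by
  have hs : ∑ p ∈ ({i, j, l} : Finset (Fin (D + 1))), f p = ∑ p, f p := by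
    refine Finset.sum_subset (Finset.subset_univ _) fun p _ hp => hf p ?_
    simp only [Finset.mem_insert, Finset.mem_singleton, not_or, Fin.ext_iff] at hp
    omega
  rw [← hs, Finset.sum_insert, Finset.sum_pair, add_assoc]
  · simp only [ne_eq, Fin.ext_iff]; omega
  · simp only [Finset.mem_insert, Finset.mem_singleton, Fin.ext_iff]; omega

/-! ### Eigenmatrix, orthogonality and Krein parameters. -/

namespace AssociationScheme

variable {X : Type*} [Fintype X] {D : ℕ} {S : AssociationScheme X D}

/-- The number of ordered pairs in the relation `R_h`. -/
noncomputable def numPairs (S : AssociationScheme X D) (h : Fin (D + 1)) : ℝ :=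
  ∑ x, ∑ y, if S.rel x y = h then 1 else 0

theorem sum_numPairs_mul (f : Fin (D + 1) → ℝ) :
    ∑ h, S.numPairs h * f h = ∑ x, ∑ y, f (S.rel x y) := by
  simp only [numPairs, Finset.sum_mul]
  rw [Finset.sum_comm]
  refine Finset.sum_congr rfl fun x _ => ?_
  rw [Finset.sum_comm]
  refine Finset.sum_congr rfl fun y _ => ?_
  simp

theorem numPairs_pos (h : Fin (D + 1)) : 0 < S.numPairs h := by
  obtain ⟨x, y, hxy⟩ := S.rel_surj h
  have hn : ∀ x y, (0 : ℝ) ≤ if S.rel x y = h then 1 else 0 := fun x y => by split_ifs <;> simp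
  refine Finset.sum_pos' (fun x _ => Finset.sum_nonneg fun y _ => hn x y)
    ⟨x, Finset.mem_univ _, Finset.sum_pos' (fun y _ => hn x y) ⟨y, Finset.mem_univ _, ?_⟩⟩
  simp [hxy]

theorem rel_self (S : AssociationScheme X D) (x : X) : S.rel x x = 0 :=
  (S.rel_eq_zero_iff x x).2 rfl

namespace IsPrimitiveIdempotents

variable [DecidableEq X] {E : Fin (D + 1) → Matrix X X ℝ}

/-- The second eigenmatrix: `|X| E_i = ∑_h Q_{h,i} A_h`. -/
noncomputable def eigenmatrix (hE : S.IsPrimitiveIdempotents E) (i h : Fin (D + 1)) : ℝ :=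
  (Fintype.card X : ℝ) * ((mem_boseMesner_iff (E i)).1 (hE.mem i)).choose h

variable (hE : S.IsPrimitiveIdempotents E)

theorem eigenmatrix_rel (i : Fin (D + 1)) (x y : X) :
    hE.eigenmatrix i (S.rel x y) = (Fintype.card X : ℝ) * E i x y := by
  rw [((mem_boseMesner_iff (E i)).1 (hE.mem i)).choose_spec x y]
  rfl

theorem eigenmatrix_zero (h : Fin (D + 1)) : hE.eigenmatrix 0 h = 1 := by
  obtain ⟨x, y, rfl⟩ := S.rel_surj h
  rw [eigenmatrix_rel, hE.zero]
  simp [S.card_ne_zero]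

theorem eigenmatrix_one (h : Fin (D + 1)) : hE.eigenmatrix 1 h = hE.dualEigenvalue h := by
  obtain ⟨x, y, rfl⟩ := S.rel_surj h
  rw [eigenmatrix_rel, hE.dualEigenvalue_spec]
  simp [Matrix.sum_apply, adj, S.card_ne_zero]

theorem apply_symm (hE : S.IsPrimitiveIdempotents E) (i : Fin (D + 1)) (x y : X) : E i x y = E i y x := by
  have h := hE.eigenmatrix_rel i x y
  rw [S.rel_symm, hE.eigenmatrix_rel] at h
  exact (mul_left_cancel₀ S.card_ne_zero h).symm

theorem eigenmatrix_mul (i j h : Fin (D + 1)) :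
    hE.eigenmatrix i h * hE.eigenmatrix j h = ∑ l, hE.krein i j l * hE.eigenmatrix l h := by
  obtain ⟨x, y, rfl⟩ := S.rel_surj h
  have h := congrFun (congrFun (hE.krein_spec i j) x) y
  simp only [Matrix.hadamard_apply, Matrix.smul_apply, Matrix.sum_apply, smul_eq_mul] at h
  simp only [eigenmatrix_rel]
  have e : ∑ l, hE.krein i j l * ((Fintype.card X : ℝ) * E l x y) =
      (Fintype.card X : ℝ) * ∑ l, hE.krein i j l * E l x y := by
    rw [Finset.mul_sum]
    exact Finset.sum_congr rfl fun l _ => by ring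
  rw [e]
  have hn := S.card_ne_zero
  field_simp at h
  linear_combination (Fintype.card X : ℝ) * h

/-- Both sides are |X|² times the trace of E_i E_j. -/
theorem orthogonality (i j : Fin (D + 1)) :
    ∑ h, S.numPairs h * (hE.eigenmatrix i h * hE.eigenmatrix j h) =
      if i = j then (Fintype.card X : ℝ) ^ 2 * hE.eigenmatrix i 0 else 0 := by
  have e : ∑ h, S.numPairs h * (hE.eigenmatrix i h * hE.eigenmatrix j h) =
      (Fintype.card X : ℝ) ^ 2 * ∑ x, (E i * E j) x x := by
    rw [sum_numPairs_mul, Finset.mul_sum]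
    refine Finset.sum_congr rfl fun x _ => ?_
    rw [Matrix.mul_apply, Finset.mul_sum]
    refine Finset.sum_congr rfl fun y _ => ?_
    rw [eigenmatrix_rel, eigenmatrix_rel, hE.apply_symm j y x]
    ring
  rw [e]
  split_ifs with hij
  · subst hij
    rw [hE.idem]
    have hx : ∀ x, E i x x = hE.eigenmatrix i 0 / (Fintype.card X : ℝ) := fun x => by
      rw [← S.rel_self x, eigenmatrix_rel, mul_div_cancel_left₀ _ S.card_ne_zero]
    simp only [hx, Finset.sum_const, Finset.card_univ, nsmul_eq_mul]
    rw [mul_div_cancel₀ _ S.card_ne_zero]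
  · simp [hE.orthogonal i j hij]

theorem eigenmatrix_zero_pos (i : Fin (D + 1)) : 0 < hE.eigenmatrix i 0 := by
  have h := hE.orthogonality i i
  rw [if_pos rfl] at h
  have hpos : 0 < ∑ h, S.numPairs h * (hE.eigenmatrix i h * hE.eigenmatrix i h) := by
    obtain ⟨x, y, hxy⟩ : ∃ x y, E i x y ≠ 0 := by
      by_contra! hcon
      exact hE.ne_zero i (by ext x y; exact hcon x y)
    refine Finset.sum_pos' (fun h _ => mul_nonneg (numPairs_pos h).le (mul_self_nonneg _))
      ⟨S.rel x y, Finset.mem_univ _, mul_pos (numPairs_pos _) (mul_self_pos.2 ?_)⟩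
    rw [eigenmatrix_rel]
    exact mul_ne_zero S.card_ne_zero hxy
  rw [h] at hpos
  have := sq_nonneg (Fintype.card X : ℝ)
  exact pos_of_mul_pos_right hpos this

/-- Expresses Krein parameters through a sum symmetric in all three indices, the source of both
their symmetry and their nonnegativity. -/
theorem sum_eigenmatrix_triple (i j l : Fin (D + 1)) :
    ∑ h, S.numPairs h * (hE.eigenmatrix i h * hE.eigenmatrix j h * hE.eigenmatrix l h) =
      (Fintype.card X : ℝ) ^ 2 * (hE.krein i j l * hE.eigenmatrix l 0) := by
  simp only [eigenmatrix_mul, Finset.sum_mul, Finset.mul_sum]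
  rw [Finset.sum_comm]
  have : ∀ p, ∑ h, S.numPairs h * (hE.krein i j p * hE.eigenmatrix p h * hE.eigenmatrix l h) =
      hE.krein i j p * if p = l then (Fintype.card X : ℝ) ^ 2 * hE.eigenmatrix p 0 else 0 := by
    intro p
    rw [← hE.orthogonality, Finset.mul_sum]
    exact Finset.sum_congr rfl fun h _ => by ring
  simp only [this]
  simp
  ring

theorem krein_mul_symm (i j : Fin (D + 1)) :
    hE.krein 1 i j * hE.eigenmatrix j 0 = hE.krein 1 j i * hE.eigenmatrix i 0 := by
  have h1 := hE.sum_eigenmatrix_triple 1 i j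
  have h2 := hE.sum_eigenmatrix_triple 1 j i
  have : (Fintype.card X : ℝ) ^ 2 ≠ 0 := pow_ne_zero _ S.card_ne_zero
  refine mul_left_cancel₀ this ?_
  rw [← h1, ← h2]
  exact Finset.sum_congr rfl fun h _ => by ring

/-- The Krein condition. -/
theorem krein_nonneg (i j l : Fin (D + 1)) : 0 ≤ hE.krein i j l := by
  -- Each E is a symmetric idempotent, so its entries are Gram products of its rows; the triple
  -- product is then a Gram kernel, and summing it over x and y gives squares.
  have hsq : ∑ x, ∑ y, E i x y * E j x y * E l x y =
      ∑ a, ∑ b, ∑ c, (∑ x, E i x a * E j x b * E l x c) ^ 2 := by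
    have hexp : ∀ p x y, E p x y = ∑ a, E p x a * E p y a := by
      intro p x y
      conv_lhs => rw [← hE.idem p, Matrix.mul_apply]
      exact Finset.sum_congr rfl fun a _ => by rw [hE.apply_symm p a y]
    have hl : ∀ x y, E i x y * E j x y * E l x y =
        ∑ a, ∑ b, ∑ c, (E i x a * E j x b * E l x c) * (E i y a * E j y b * E l y c) := by
      intro x y
      rw [hexp i, hexp j, hexp l, Finset.sum_mul_sum, Finset.sum_mul]
      refine Finset.sum_congr rfl fun a _ => ?_
      rw [Finset.sum_mul]
      refine Finset.sum_congr rfl fun b _ => ?_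
      rw [Finset.mul_sum]
      exact Finset.sum_congr rfl fun c _ => by ring
    simp only [hl, sq, Finset.sum_mul_sum]
    have swap : ∀ F : X → X → X → ℝ,
        ∑ x, ∑ y, ∑ a, F x y a = ∑ a, ∑ x, ∑ y, F x y a := by
      intro F
      rw [Finset.sum_comm' (t' := Finset.univ) (s' := fun _ => Finset.univ) (by simp)]
      rw [Finset.sum_congr rfl fun y _ => Finset.sum_comm, Finset.sum_comm]
      exact Finset.sum_congr rfl fun a _ => Finset.sum_comm
    rw [swap]
    refine Finset.sum_congr rfl fun a _ => ?_
    rw [swap]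
    refine Finset.sum_congr rfl fun b _ => ?_
    rw [swap]
  have h := hE.sum_eigenmatrix_triple i j l
  rw [sum_numPairs_mul] at h
  have h3 : ∑ x, ∑ y, hE.eigenmatrix i (S.rel x y) * hE.eigenmatrix j (S.rel x y) *
      hE.eigenmatrix l (S.rel x y) =
      (Fintype.card X : ℝ) ^ 3 * ∑ x, ∑ y, E i x y * E j x y * E l x y := by
    simp only [eigenmatrix_rel, Finset.mul_sum]
    exact Finset.sum_congr rfl fun x _ => Finset.sum_congr rfl fun y _ => by ring
  rw [h3, hsq] at h
  have hn : 0 < (Fintype.card X : ℝ) := lt_of_le_of_ne (Nat.cast_nonneg _) S.card_ne_zero.symm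
  have hnn : 0 ≤ ∑ a, ∑ b, ∑ c, (∑ x, E i x a * E j x b * E l x c) ^ 2 :=
    Finset.sum_nonneg fun a _ => Finset.sum_nonneg fun b _ => Finset.sum_nonneg fun c _ =>
      sq_nonneg _
  have h0 : 0 ≤ (Fintype.card X : ℝ) ^ 2 * (hE.krein i j l * hE.eigenmatrix l 0) := by
    rw [← h]
    positivity
  exact nonneg_of_mul_nonneg_left (nonneg_of_mul_nonneg_right h0 (by positivity))
    (hE.eigenmatrix_zero_pos l)

theorem krein_one_zero_one : hE.krein 1 0 1 = 1 := by
  have h := hE.sum_eigenmatrix_triple 1 0 1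
  simp only [eigenmatrix_zero, mul_one] at h
  rw [hE.orthogonality, if_pos rfl] at h
  have h1 : (Fintype.card X : ℝ) ^ 2 ≠ 0 := pow_ne_zero _ S.card_ne_zero
  have h2 := (hE.eigenmatrix_zero_pos 1).ne'
  have h3 := mul_left_cancel₀ h1 h
  exact mul_right_cancel₀ h2 (by linarith)

/-- Evaluate the Krein expansion at the relation R_0 and move the multiplicities across with
`krein_mul_symm`. -/
theorem sum_krein (i : Fin (D + 1)) : ∑ j, hE.krein 1 j i = hE.dualEigenvalue 0 := by
  have h := hE.eigenmatrix_mul 1 i 0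
  simp only [hE.krein_mul_symm i, ← Finset.sum_mul] at h
  rw [← eigenmatrix_one]
  exact (mul_right_cancel₀ (hE.eigenmatrix_zero_pos i).ne' h).symm

/-! ### Consequences of the Q-polynomial property. -/

theorem exists_polynomial (hQ : hE.IsQPolynomial) : ∃ v : Fin (D + 1) → Polynomial ℝ,
    (∀ i, (v i).degree = ((i : ℕ) : WithBot ℕ)) ∧
      ∀ i h, hE.eigenmatrix i h = (v i).eval (hE.dualEigenvalue h) := by
  choose v hv hv' using hQ
  refine ⟨v, hv, fun i h => ?_⟩
  obtain ⟨x, y, rfl⟩ := S.rel_surj h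
  rw [← eigenmatrix_one, eigenmatrix_rel, eigenmatrix_rel, hv']

/-- Relations sharing a dual eigenvalue would receive equal entries in every E_i, hence in every
adjacency matrix, yet adjacency matrices separate relations. -/
theorem dualEigenvalue_injective (hQ : hE.IsQPolynomial) :
    Function.Injective hE.dualEigenvalue := by
  obtain ⟨v, -, hv⟩ := hE.exists_polynomial hQ
  intro h h' hh
  obtain ⟨x, y, rfl⟩ := S.rel_surj h
  obtain ⟨x', y', rfl⟩ := S.rel_surj h'
  have hEeq : ∀ i, E i x y = E i x' y' := by
    intro i
    refine mul_left_cancel₀ S.card_ne_zero ?_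
    rw [← hE.eigenmatrix_rel, ← hE.eigenmatrix_rel, hv, hv, hh]
  have hmem : S.adj (S.rel x y) ∈ Submodule.span ℝ (Set.range E) := by
    rw [hE.span_eq]
    exact Submodule.subset_span ⟨_, rfl⟩
  obtain ⟨c, hc⟩ := (Submodule.mem_span_range_iff_exists_fun ℝ).1 hmem
  have h1 : S.adj (S.rel x y) x y = S.adj (S.rel x y) x' y' := by
    rw [← hc]
    simp [Matrix.sum_apply, hEeq]
  by_contra hne
  simp [adj, Ne.symm hne] at h1

/-- The v_j with j < d span the polynomials of degree below d; the induction strips off leading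
terms. -/
theorem sum_eval_mul_eq_zero {v : Fin (D + 1) → Polynomial ℝ}
    (hdeg : ∀ i, (v i).degree = ((i : ℕ) : WithBot ℕ))
    (hv : ∀ i h, hE.eigenmatrix i h = (v i).eval (hE.dualEigenvalue h))
    (i : Fin (D + 1)) (d : ℕ) (hd : d ≤ i) (p : Polynomial ℝ) (hp : p.degree < (d : WithBot ℕ)) :
    ∑ h, S.numPairs h * (p.eval (hE.dualEigenvalue h) * hE.eigenmatrix i h) = 0 := by
  induction d generalizing p with
  | zero =>
    have : p = 0 := by
      rw [← Polynomial.degree_eq_bot]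
      simpa using hp
    simp [this]
  | succ d ih =>
    let j : Fin (D + 1) := ⟨d, by omega⟩
    have hlead : (v j).coeff d ≠ 0 :=
       Polynomial.coeff_ne_zero_of_eq_degree (hdeg j)
    let k := p.coeff d / (v j).coeff d
    have hq : (p - Polynomial.C k * v j).degree < (d : WithBot ℕ) := by
      rw [Polynomial.degree_lt_iff_coeff_zero]
      intro n hn
      rcases hn.eq_or_lt with rfl | hlt
      · simp [k, div_mul_cancel₀ _ hlead]
      · have h1 : p.coeff n = 0 := by
          rw [Polynomial.degree_lt_iff_coeff_zero] at hp
          exact hp n hlt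
        have h2 : (v j).coeff n = 0 := by
          apply Polynomial.coeff_eq_zero_of_degree_lt
          rw [hdeg j]
          exact_mod_cast hlt
        simp [h1, h2]
    have h1 := ih (by omega) _ hq
    have h2 := hE.orthogonality j i
    rw [if_neg (fun hji => by rw [← hji] at hd; exact Nat.not_succ_le_self d hd)] at h2
    have : ∀ h, S.numPairs h * (p.eval (hE.dualEigenvalue h) * hE.eigenmatrix i h) =
        S.numPairs h * ((p - Polynomial.C k * v j).eval (hE.dualEigenvalue h) *
          hE.eigenmatrix i h) +
        k * (S.numPairs h * (hE.eigenmatrix j h * hE.eigenmatrix i h)) := by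
      intro h
      rw [hv j]
      simp only [Polynomial.eval_sub, Polynomial.eval_mul, Polynomial.eval_C]
      ring
    simp only [this, Finset.sum_add_distrib, ← Finset.mul_sum, h1, h2]
    simp

theorem krein_eq_zero (hQ : hE.IsQPolynomial) (i j : Fin (D + 1)) (hij : (i : ℕ) + 1 < j) :
    hE.krein 1 i j = 0 := by
  obtain ⟨v, hdeg, hv⟩ := hE.exists_polynomial hQ
  have h := hE.sum_eigenmatrix_triple 1 i j
  have h0 := hE.sum_eval_mul_eq_zero hdeg hv j j le_rfl (Polynomial.X * v i) (by
    rw [Polynomial.degree_mul, hdeg, Polynomial.degree_X, add_comm]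
    exact_mod_cast hij)
  simp only [Polynomial.eval_mul, Polynomial.eval_X, ← hv] at h0
  simp only [← eigenmatrix_one] at h0
  rw [h0] at h
  have h1 : (Fintype.card X : ℝ) ^ 2 ≠ 0 := pow_ne_zero _ S.card_ne_zero
  exact (mul_eq_zero.1 ((mul_eq_zero.1 h.symm).resolve_left h1)).resolve_right
    (hE.eigenmatrix_zero_pos j).ne'

theorem krein_eq_zero_of_gt (hQ : hE.IsQPolynomial) (i j : Fin (D + 1)) (hij : (j : ℕ) + 1 < i) :
    hE.krein 1 i j = 0 := by
  have h := hE.krein_mul_symm i j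
  rw [hE.krein_eq_zero hQ j i hij, zero_mul] at h
  exact (mul_eq_zero.1 h).resolve_right (hE.eigenmatrix_zero_pos j).ne'

/-- If this parameter vanished, X v_i would agree at all D + 1 dual eigenvalues with a polynomial of
lower degree. Both have degree at most D, so they would be equal. -/
theorem krein_succ_pos (hQ : hE.IsQPolynomial) (i j : Fin (D + 1)) (hij : (j : ℕ) = i + 1) :
    0 < hE.krein 1 i j := by
  refine lt_of_le_of_ne (hE.krein_nonneg 1 i j) fun h0 => ?_
  obtain ⟨v, hdeg, hv⟩ := hE.exists_polynomial hQ
  have hlow : (∑ l, Polynomial.C (hE.krein 1 i l) * v l).degree < ((j : ℕ) : WithBot ℕ) := by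
    rw [Polynomial.degree_lt_iff_coeff_zero]
    intro n hn
    rw [Polynomial.finsetSum_coeff]
    refine Finset.sum_eq_zero fun l _ => ?_
    rw [Polynomial.coeff_C_mul]
    rcases lt_trichotomy (l : ℕ) j with hlt | heq | hgt
    · rw [Polynomial.coeff_eq_zero_of_degree_lt (by rw [hdeg]; exact_mod_cast by omega), mul_zero]
    · rw [Fin.ext heq, ← h0, zero_mul]
    · rw [hE.krein_eq_zero hQ i l (by omega), zero_mul]
  have htop : (Polynomial.X * v i).degree = ((j : ℕ) : WithBot ℕ) := by
    rw [Polynomial.degree_mul, hdeg, Polynomial.degree_X, add_comm, hij]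
    norm_cast
  have heq : Polynomial.X * v i = ∑ l, Polynomial.C (hE.krein 1 i l) * v l := by
    refine Polynomial.eq_of_degrees_lt_of_eval_index_eq (s := Finset.univ)
      (v := hE.dualEigenvalue) (hE.dualEigenvalue_injective hQ).injOn ?_ ?_ fun h _ => ?_
    · rw [htop]
      simp only [Finset.card_univ, Fintype.card_fin]
      exact_mod_cast j.2
    · refine hlow.trans ?_
      simp only [Finset.card_univ, Fintype.card_fin]
      exact_mod_cast j.2
    · simp only [Polynomial.eval_mul, Polynomial.eval_X, Polynomial.eval_finsetSum,
        Polynomial.eval_C, ← hv]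
      rw [← eigenmatrix_one, eigenmatrix_mul]
  rw [heq] at htop
  exact hlow.ne htop

theorem krein_pred_pos (hQ : hE.IsQPolynomial) (i j : Fin (D + 1)) (hij : (i : ℕ) = j + 1) :
    0 < hE.krein 1 i j := by
  have h := hE.krein_mul_symm i j
  have hp := mul_pos (hE.krein_succ_pos hQ j i hij) (hE.eigenmatrix_zero_pos i)
  rw [← h] at hp
  exact pos_of_mul_pos_left hp (hE.eigenmatrix_zero_pos j).le

theorem three_term (hQ : hE.IsQPolynomial) (i j l : Fin (D + 1)) (hij : (j : ℕ) = i + 1)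
    (hjl : (l : ℕ) = j + 1) (h : Fin (D + 1)) :
    hE.dualEigenvalue h * hE.eigenmatrix j h = hE.krein 1 j i * hE.eigenmatrix i h +
      hE.krein 1 j j * hE.eigenmatrix j h + hE.krein 1 j l * hE.eigenmatrix l h := by
  rw [← eigenmatrix_one, eigenmatrix_mul]
  refine sum_three_consecutive i j l hij hjl fun p hp => ?_
  rcases hp with hp | hp
  · rw [hE.krein_eq_zero_of_gt hQ j p hp, zero_mul]
  · rw [hE.krein_eq_zero hQ j p hp, zero_mul]

theorem krein_add_three (hQ : hE.IsQPolynomial) (i j l : Fin (D + 1)) (hij : (j : ℕ) = i + 1)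
    (hjl : (l : ℕ) = j + 1) :
    hE.krein 1 i j + hE.krein 1 j j + hE.krein 1 l j = hE.dualEigenvalue 0 := by
  rw [← hE.sum_krein j]
  refine (sum_three_consecutive (f := fun p => hE.krein 1 p j) i j l hij hjl fun p hp => ?_).symm
  rcases hp with hp | hp
  · exact hE.krein_eq_zero hQ p j hp
  · exact hE.krein_eq_zero_of_gt hQ p j hp

end IsPrimitiveIdempotents

end AssociationScheme

/-! ### The reflected node estimate. -/

/-- The product of the largest node and the two least nodes of a positive discrete measure,
compared with the product of the roots of its orthogonal polynomial of degree three. -/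
theorem le_mul_three_nodes {ι : Type*} (s : Finset ι) (w t : ι → ℝ) (hw : ∀ i ∈ s, 0 < w i)
    {i₁ i₂ i₃ : ι} (m₁ : i₁ ∈ s) (m₂ : i₂ ∈ s) (m₃ : i₃ ∈ s) (h21 : t i₂ < t i₁) (h32 : t i₃ < t i₂)
    (hmid : ∀ i ∈ s, i ≠ i₁ → i ≠ i₂ → i ≠ i₃ → t i₂ < t i ∧ t i < t i₁)
    {a b c β : ℝ} (hb : 0 < b) (hβ : 0 < β) (hc : c ≤ 0)
    (ho : ∀ x y z : ℝ, ∑ i ∈ s, w i * (((t i - c) * (t i ^ 2 - a * t i - b) - β * t i) *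
      (x + y * t i + z * t i ^ 2)) = 0) :
    -b * c ≤ t i₁ * t i₂ * t i₃ ∧
      (t i₁ * t i₂ * t i₃ = -b * c ↔ ∀ i ∈ s, i = i₁ ∨ i = i₂ ∨ i = i₃) := by
  -- Under t ↦ −t the cubic with parameters −a, −c becomes minus the original one, and the order of
  -- the nodes reverses.
  obtain ⟨hle, heq⟩ := mul_three_nodes_le s w (fun i => -t i) hw m₃ m₂ m₁
    (neg_lt_neg h32) (neg_lt_neg h21) (fun i hi h3 h2 h1 =>
      ⟨neg_lt_neg (hmid i hi h1 h2 h3).2, neg_lt_neg (hmid i hi h1 h2 h3).1⟩)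
    (a := -a) (c := -c) hb hβ (by linarith) (fun x y z => by
      rw [← neg_eq_zero, ← ho x (-y) z, ← Finset.sum_neg_distrib]
      exact Finset.sum_congr rfl fun i _ => by ring)
  refine ⟨by linarith, ?_⟩
  have : t i₁ * t i₂ * t i₃ = -b * c ↔ -t i₃ * -t i₂ * -t i₁ = -b * -c := by
    constructor <;> intro h <;> linear_combination -h
  rw [this, heq]
  refine forall₂_congr fun i _ => ?_
  tauto

/-! ### Moments and orthogonality for the Christoffel-modified measure. -/

namespace AssociationScheme.IsPrimitiveIdempotents

variable {X : Type*} [Fintype X] [DecidableEq X] {D : ℕ} {S : AssociationScheme X D}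
  {E : Fin (D + 1) → Matrix X X ℝ}

/-- Parseval's identity, which turns sums over relations into finite algebra in the parameters. -/
theorem sum_mul_combination (hE : S.IsPrimitiveIdempotents E) {k : ℕ} {f : Fin k → Fin (D + 1)}
    (hf : Function.Injective f) (x y : Fin k → ℝ) :
    ∑ h, S.numPairs h * ((∑ i, x i * hE.eigenmatrix (f i) h) *
      ∑ j, y j * hE.eigenmatrix (f j) h) =
    (Fintype.card X : ℝ) ^ 2 * ∑ i, x i * y i * hE.eigenmatrix (f i) 0 := by
  simp only [Finset.sum_mul_sum]
  simp only [Finset.mul_sum]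
  rw [Finset.sum_comm]
  refine Finset.sum_congr rfl fun i _ => ?_
  rw [Finset.sum_comm]
  have : ∀ j, ∑ h, S.numPairs h * (x i * hE.eigenmatrix (f i) h * (y j * hE.eigenmatrix (f j) h)) =
      if i = j then x i * y j * ((Fintype.card X : ℝ) ^ 2 * hE.eigenmatrix (f i) 0) else 0 := by
    intro j
    have ho := hE.orthogonality (f i) (f j)
    simp only [hf.eq_iff] at ho
    rw [← mul_ite_zero, ← ho, Finset.mul_sum]
    exact Finset.sum_congr rfl fun h _ => by ring
  simp only [this]
  simp
  ring

/-- The numeral `1` in `Fin (D + 1)` is reduced modulo D + 1, so an index of value 2 is needed to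
know that D is large enough. -/
theorem _root_.Fin.val_one_of_val_eq_two {i : Fin (D + 1)} (hi : (i : ℕ) = 2) :
    ((1 : Fin (D + 1)) : ℕ) = 1 :=
  Nat.mod_eq_of_lt (show 1 < D + 1 by have := i.2; omega)

theorem dualEigenvalue_sq (hE : S.IsPrimitiveIdempotents E) (hQ : hE.IsQPolynomial)
    {i₂ : Fin (D + 1)} (hi₂ : (i₂ : ℕ) = 2) (h : Fin (D + 1)) :
    hE.dualEigenvalue h ^ 2 = hE.dualEigenvalue 0 + hE.krein 1 1 1 * hE.dualEigenvalue h +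
      hE.krein 1 1 i₂ * hE.eigenmatrix i₂ h := by
  have h1 := Fin.val_one_of_val_eq_two hi₂
  have h3 := hE.three_term hQ 0 1 i₂ (by rw [h1]; rfl) (by rw [h1, hi₂]) h
  have h4 := hE.krein_mul_symm 1 0
  rw [hE.krein_one_zero_one, eigenmatrix_zero, eigenmatrix_one, mul_one, one_mul] at h4
  rw [eigenmatrix_one, h4, eigenmatrix_zero, mul_one] at h3
  rw [sq, h3]

theorem krein_add_one (hE : S.IsPrimitiveIdempotents E) (hQ : hE.IsQPolynomial)
    {i₂ : Fin (D + 1)} (hi₂ : (i₂ : ℕ) = 2) :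
    1 + hE.krein 1 1 1 + hE.krein 1 i₂ 1 = hE.dualEigenvalue 0 := by
  have h1 := Fin.val_one_of_val_eq_two hi₂
  have := hE.krein_add_three hQ 0 1 i₂ (by rw [h1]; rfl) (by rw [h1, hi₂])
  rwa [krein_one_zero_one] at this

/-- The weights of the measure on the dual eigenvalues `θ*_1, …, θ*_D`. -/
noncomputable def weight (hE : S.IsPrimitiveIdempotents E) (h : Fin (D + 1)) : ℝ :=
  S.numPairs h * (hE.dualEigenvalue 0 - hE.dualEigenvalue h)

theorem sum_erase_weight (hE : S.IsPrimitiveIdempotents E) (f : Fin (D + 1) → ℝ) :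
    ∑ h ∈ Finset.univ.erase 0, hE.weight h * f h = ∑ h, hE.weight h * f h :=
  Finset.sum_erase _ (by simp [weight])

theorem sum_weight_mul (hE : S.IsPrimitiveIdempotents E) (hQ : hE.IsQPolynomial)
    {i₂ : Fin (D + 1)} (hi₂ : (i₂ : ℕ) = 2) (x y z : ℝ) :
    ∑ h, hE.weight h * (x + y * (hE.dualEigenvalue h + 1) + z * (hE.dualEigenvalue h + 1) ^ 2) =
      (Fintype.card X : ℝ) ^ 2 * hE.dualEigenvalue 0 *
        (x + z * hE.krein 1 i₂ 1) := by
  have h1 := Fin.val_one_of_val_eq_two hi₂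
  have hval : ∀ i, ((![(0 : Fin (D + 1)), 1, i₂] i : Fin (D + 1)) : ℕ) = i := by
    intro i
    fin_cases i
    exacts [rfl, h1, hi₂]
  have hinj : Function.Injective ![(0 : Fin (D + 1)), 1, i₂] := fun i j hij =>
    Fin.ext (by rw [← hval i, ← hval j, hij])
  -- The first vector is m − θ* in the basis v_0, v_1, v_2; the second is x + y t + z t² with t = θ*
  -- + 1.
  have hc := hE.sum_mul_combination hinj ![hE.dualEigenvalue 0, -1, 0]
    ![x + y + z + z * hE.dualEigenvalue 0, y + 2 * z + z * hE.krein 1 1 1,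
      z * hE.krein 1 1 i₂]
  simp only [Fin.sum_univ_three, Matrix.cons_val, eigenmatrix_zero, eigenmatrix_one] at hc
  have hs := hE.krein_add_one hQ hi₂
  calc _ = _ := Finset.sum_congr rfl fun h _ => ?_
    _ = _ := hc
    _ = _ := ?_
  · have hq := hE.dualEigenvalue_sq hQ hi₂ h
    rw [weight]
    linear_combination S.numPairs h * (hE.dualEigenvalue 0 - hE.dualEigenvalue h) * z * hq
  · linear_combination -(Fintype.card X : ℝ) ^ 2 * hE.dualEigenvalue 0 * z * hs

/-- The cubic is c₂c₃(v_0 + v_1 + v_2 + v_3), and (m − θ*) times a quadratic has degree at most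
three. Pairing them evaluates that product at R_0, where m − θ* vanishes. -/
theorem sum_weight_mul_cubic (hE : S.IsPrimitiveIdempotents E) (hQ : hE.IsQPolynomial)
    {i₂ i₃ : Fin (D + 1)} (hi₂ : (i₂ : ℕ) = 2) (hi₃ : (i₃ : ℕ) = 3)
    {a b₁ b₂ c₂ c₃ : ℝ} (ha : a = 2 + hE.krein 1 1 1 - c₂)
    (hb₁ : b₁ = hE.krein 1 i₂ 1) (hb₂ : b₂ = hE.krein 1 i₃ i₂)
    (hc₂ : c₂ = hE.krein 1 1 i₂) (hc₃ : c₃ = hE.krein 1 i₂ i₃)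
    (x y z : ℝ) :
    ∑ h, hE.weight h * (((hE.dualEigenvalue h + 1 - (hE.dualEigenvalue 0 + 1 - b₂ - c₃)) *
      ((hE.dualEigenvalue h + 1) ^ 2 - a * (hE.dualEigenvalue h + 1) - b₁) -
        c₂ * b₂ * (hE.dualEigenvalue h + 1)) *
      (x + y * (hE.dualEigenvalue h + 1) + z * (hE.dualEigenvalue h + 1) ^ 2)) = 0 := by
  have h1 := Fin.val_one_of_val_eq_two hi₂
  have hval : ∀ i, ((![(0 : Fin (D + 1)), 1, i₂, i₃] i : Fin (D + 1)) : ℕ) = i := by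
    intro i
    fin_cases i
    exacts [rfl, h1, hi₂, hi₃]
  have hinj : Function.Injective ![(0 : Fin (D + 1)), 1, i₂, i₃] := fun i j hij =>
    Fin.ext (by rw [← hval i, ← hval j, hij])
  have hs₁ := hE.krein_add_one hQ hi₂
  have hs₂ := hE.krein_add_three hQ 1 i₂ i₃ (by rw [h1, hi₂]) (by rw [hi₂, hi₃])
  have hd₂ := hE.krein_mul_symm 1 i₂
  have hd₃ := hE.krein_mul_symm i₂ i₃
  have hq₁ := hE.dualEigenvalue_sq hQ hi₂
  have hq₂ := hE.three_term hQ 1 i₂ i₃ (by rw [h1, hi₂]) (by rw [hi₂, hi₃])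
  simp only [eigenmatrix_one] at hd₂ hq₂
  rw [← hb₁, ← hc₂] at hd₂
  rw [← hb₂, ← hc₃] at hd₃
  rw [← hb₁] at hs₁
  rw [← hb₂, ← hc₂] at hs₂
  simp only [← hc₂] at hq₁
  simp only [← hb₁, ← hc₃] at hq₂
  generalize hE.krein 1 1 1 = a₁ at *
  generalize hE.krein 1 i₂ i₂ = a₂ at *
  -- The first vector expands (m − θ*)(A v_0 + B v_1 + C v_2) by the three-term recurrence; the
  -- second is the kernel sum.
  have key : ∀ A B C : ℝ, _ := fun A B C => hE.sum_mul_combination hinj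
    ![hE.dualEigenvalue 0 * A - hE.dualEigenvalue 0 * B,
      -A + hE.dualEigenvalue 0 * B - a₁ * B - C * b₁,
      -B * c₂ + hE.dualEigenvalue 0 * C - C * a₂, -C * c₃] ![1, 1, 1, 1]
  simp only [Fin.sum_univ_four, Matrix.cons_val, eigenmatrix_zero, eigenmatrix_one] at key
  have hc := key (x + y + z + z * hE.dualEigenvalue 0) (y + 2 * z + z * a₁) (z * c₂)
  calc _ = ∑ h, c₂ * c₃ * _ := Finset.sum_congr rfl fun h _ => ?_
    _ = _ := (Finset.mul_sum _ _ _).symm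
    _ = _ := by rw [hc]
    _ = _ := ?_
  · have e1 := hq₁ h
    have e2 := hq₂ h
    have eV : (hE.dualEigenvalue h + 1 - (hE.dualEigenvalue 0 + 1 - b₂ - c₃)) *
        ((hE.dualEigenvalue h + 1) ^ 2 - a * (hE.dualEigenvalue h + 1) - b₁) -
        c₂ * b₂ * (hE.dualEigenvalue h + 1) = c₂ * c₃ * (1 + hE.dualEigenvalue h +
        hE.eigenmatrix i₂ h + hE.eigenmatrix i₃ h) := by
      subst ha
      have ha₂ : a₂ = hE.dualEigenvalue 0 - c₂ - b₂ := by linarith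
      have hm : b₁ = hE.dualEigenvalue 0 - 1 - a₁ := by linarith
      rw [ha₂, hm] at e2
      rw [hm]
      linear_combination (hE.dualEigenvalue h - (hE.dualEigenvalue 0 - c₂ - b₂) + c₃) * e1 + c₂ * e2
    have eW : (hE.dualEigenvalue 0 - hE.dualEigenvalue h) *
        (x + y * (hE.dualEigenvalue h + 1) + z * (hE.dualEigenvalue h + 1) ^ 2) =
        (hE.dualEigenvalue 0 * (x + y + z + z * hE.dualEigenvalue 0) -
          hE.dualEigenvalue 0 * (y + 2 * z + z * a₁)) +
        (-(x + y + z + z * hE.dualEigenvalue 0) + hE.dualEigenvalue 0 * (y + 2 * z + z * a₁) -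
          a₁ * (y + 2 * z + z * a₁) - z * c₂ * b₁) * hE.dualEigenvalue h +
        (-(y + 2 * z + z * a₁) * c₂ + hE.dualEigenvalue 0 * (z * c₂) - z * c₂ * a₂) *
          hE.eigenmatrix i₂ h + -(z * c₂) * c₃ * hE.eigenmatrix i₃ h := by
      linear_combination ((hE.dualEigenvalue 0 - hE.dualEigenvalue h) * z -
        (y + 2 * z + z * a₁)) * e1 - z * c₂ * e2
    rw [weight, eV]
    linear_combination S.numPairs h * c₂ * c₃ * (1 + hE.dualEigenvalue h +
        hE.eigenmatrix i₂ h + hE.eigenmatrix i₃ h) * eW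
  -- The remaining value at R_0 cancels through c*_i m_i = b*_{i−1} m_{i−1} for i = 2, 3, where m_i
  -- is the rank of E_i.
  · have ha₂ : a₂ = hE.dualEigenvalue 0 - c₂ - b₂ := by linarith
    have hm : a₁ = hE.dualEigenvalue 0 - 1 - b₁ := by linarith
    subst ha₂ hm
    linear_combination c₂ * c₃ * (Fintype.card X : ℝ) ^ 2 *
      ((-(y + 2 * z + z * (hE.dualEigenvalue 0 - 1 - b₁)) + z * c₂) * hd₂ - z * c₂ * hd₃)

end AssociationScheme.IsPrimitiveIdempotents

/-! ### The main theorem. -/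

/-- The hypothesis `hθ` only fixes the labelling of the relations `R_1, …, R_D`; that the dual
eigenvalues are then strictly decreasing is part of the conclusion. The number `m` of the
statement is `θ*_0`. -/
theorem theorem4p1 {X : Type*} [Fintype X] [DecidableEq X] {D : ℕ} (hD : 2 ≤ D)
    (S : AssociationScheme X D) (E : Fin (D + 1) → Matrix X X ℝ)
    (hE : S.IsPrimitiveIdempotents E) (hQ : hE.IsQPolynomial)
    (θ : Fin (D + 1) → ℝ) (hθ_def : θ = hE.dualEigenvalue) (hθ : Antitone θ)
    (m : ℝ) (hm : m = θ 0) :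
    StrictAnti θ ∧
    ((θ ⟨1, by omega⟩ + 1) * (θ ⟨D, by omega⟩ + 1) ≤ -hE.bStar 1 (by omega) ∧
      ((θ ⟨1, by omega⟩ + 1) * (θ ⟨D, by omega⟩ + 1) = -hE.bStar 1 (by omega) ↔ D = 2)) ∧
    ∀ hD3 : 3 ≤ D,
      (hE.bStar 2 (by omega) + hE.cStar 3 (by omega) ≥ m + 1 →
        (θ ⟨1, by omega⟩ + 1) * (θ ⟨D - 1, by omega⟩ + 1) * (θ ⟨D, by omega⟩ + 1) ≥
            -hE.bStar 1 (by omega) *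
              (m + 1 - hE.bStar 2 (by omega) - hE.cStar 3 (by omega)) ∧
        ((θ ⟨1, by omega⟩ + 1) * (θ ⟨D - 1, by omega⟩ + 1) * (θ ⟨D, by omega⟩ + 1) =
            -hE.bStar 1 (by omega) *
              (m + 1 - hE.bStar 2 (by omega) - hE.cStar 3 (by omega)) ↔ D = 3)) ∧
      (hE.bStar 2 (by omega) + hE.cStar 3 (by omega) ≤ m + 1 →
        (θ ⟨1, by omega⟩ + 1) * (θ ⟨2, by omega⟩ + 1) * (θ ⟨D, by omega⟩ + 1) ≤
            -hE.bStar 1 (by omega) *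
              (m + 1 - hE.bStar 2 (by omega) - hE.cStar 3 (by omega)) ∧
        ((θ ⟨1, by omega⟩ + 1) * (θ ⟨2, by omega⟩ + 1) * (θ ⟨D, by omega⟩ + 1) =
            -hE.bStar 1 (by omega) *
              (m + 1 - hE.bStar 2 (by omega) - hE.cStar 3 (by omega)) ↔ D = 3)) := by
  subst hm hθ_def
  have hanti : StrictAnti hE.dualEigenvalue :=
    hθ.strictAnti_of_injective (hE.dualEigenvalue_injective hQ)
  have e1 : (⟨1, by omega⟩ : Fin (D + 1)) = 1 :=
    Fin.ext (Nat.mod_eq_of_lt (show 1 < D + 1 by omega)).symm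
  have hw : ∀ i ∈ Finset.univ.erase (0 : Fin (D + 1)), 0 < hE.weight i := fun i hi =>
    mul_pos (AssociationScheme.numPairs_pos i)
      (sub_pos.2 (hanti (Fin.pos_iff_ne_zero.2 (Finset.ne_of_mem_erase hi))))
  have hlt : ∀ i j : Fin (D + 1), i < j → hE.dualEigenvalue j + 1 < hE.dualEigenvalue i + 1 :=
    fun i j hij => by linarith [hanti hij]
  have hmem : ∀ (j : ℕ) (hj : j < D + 1), j ≠ 0 →
      (⟨j, hj⟩ : Fin (D + 1)) ∈ Finset.univ.erase (0 : Fin (D + 1)) := fun j hj h0 => by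
    simpa [Fin.ext_iff] using h0
  have hb₁ : hE.bStar 1 (by omega) = hE.krein 1 ⟨2, by omega⟩ 1 := by
    rw [AssociationScheme.IsPrimitiveIdempotents.bStar, ← e1]
  refine ⟨hanti, ?_, fun hD3 => ?_⟩
  · obtain ⟨hle, heq⟩ := mul_extreme_nodes_le (Finset.univ.erase (0 : Fin (D + 1))) hE.weight
      (fun h => hE.dualEigenvalue h + 1) hw (i₁ := ⟨1, by omega⟩) (i₃ := ⟨D, by omega⟩)
      (b := hE.bStar 1 (by omega)) (hmem _ _ one_ne_zero)
      (fun i hi h1 h3 => by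
        have h0 := Finset.ne_of_mem_erase hi
        simp only [ne_eq, Fin.ext_iff, Fin.val_zero] at h0 h1 h3
        exact ⟨hlt _ _ (Fin.lt_def.2 (by simp; omega)), hlt _ _ (Fin.lt_def.2 (by simp; omega))⟩)
      (by
        rw [hE.sum_erase_weight]
        simpa using hE.sum_weight_mul hQ (i₂ := ⟨2, by omega⟩) rfl 0 1 0)
      (by
        have h0 := hE.sum_weight_mul hQ (i₂ := ⟨2, by omega⟩) rfl 1 0 0
        have h2 := hE.sum_weight_mul hQ (i₂ := ⟨2, by omega⟩) rfl 0 0 1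
        have h3 := hE.sum_erase_weight fun _ => 1
        simp only [zero_mul, add_zero, zero_add, one_mul, mul_one] at h0 h2 h3
        rw [hE.sum_erase_weight, h3, h0, h2, hb₁]
        ring)
    refine ⟨hle, heq.trans ⟨fun hall => ?_, fun hD2 i hi => ?_⟩⟩
    · by_contra hne
      have := hall ⟨2, by omega⟩ (hmem _ _ two_ne_zero)
      simp only [Fin.ext_iff] at this
      omega
    · have h0 := Finset.ne_of_mem_erase hi
      simp only [ne_eq, Fin.ext_iff, Fin.val_zero] at h0 ⊢
      omega
  · have hb1pos : 0 < hE.bStar 1 (by omega) := hE.krein_pred_pos hQ _ _ rfl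
    have hb2pos : 0 < hE.bStar 2 (by omega) := hE.krein_pred_pos hQ _ _ rfl
    have hc2pos : 0 < hE.cStar 2 (by omega) := hE.krein_succ_pos hQ _ _ rfl
    have hc₂ : hE.cStar 2 (by omega) = hE.krein 1 1 ⟨2, by omega⟩ :=
      congrArg (fun i => hE.krein 1 i ⟨2, by omega⟩) e1
    have ho := hE.sum_weight_mul_cubic hQ (i₂ := ⟨2, by omega⟩) (i₃ := ⟨3, by omega⟩) rfl rfl rfl hb₁ (b₂ := hE.bStar 2 (by omega)) rfl hc₂
      (c₃ := hE.cStar 3 (by omega)) rfl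
    simp only [← hE.sum_erase_weight] at ho
    constructor
    · intro hge
      obtain ⟨hle, heq⟩ := le_mul_three_nodes (Finset.univ.erase (0 : Fin (D + 1))) hE.weight
        (fun h => hE.dualEigenvalue h + 1) hw (i₁ := ⟨1, by omega⟩) (i₂ := ⟨D - 1, by omega⟩)
        (i₃ := ⟨D, by omega⟩) (hmem _ _ one_ne_zero) (hmem _ _ (by omega)) (hmem _ _ (by omega))
        (hlt _ _ (Fin.lt_def.2 (by simp; omega))) (hlt _ _ (Fin.lt_def.2 (by simp; omega)))
        (fun i hi h1 h2 h3 => by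
          have h0 := Finset.ne_of_mem_erase hi
          simp only [ne_eq, Fin.ext_iff, Fin.val_zero] at h0 h1 h2 h3
          exact ⟨hlt _ _ (Fin.lt_def.2 (by simp; omega)), hlt _ _ (Fin.lt_def.2 (by simp; omega))⟩)
        hb1pos (mul_pos hc2pos hb2pos) (by linarith) ho
      refine ⟨hle, heq.trans ⟨fun hall => ?_, fun hD2 i hi => ?_⟩⟩
      · by_contra hne
        -- Index 2 must be D − 1 or D, and D ≥ 3 leaves only D = 3.
        have := hall ⟨2, by omega⟩ (hmem _ _ two_ne_zero)
        simp only [Fin.ext_iff] at this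
        omega
      · have h0 := Finset.ne_of_mem_erase hi
        simp only [ne_eq, Fin.ext_iff, Fin.val_zero] at h0 ⊢
        omega
    · intro hge
      obtain ⟨hle, heq⟩ := mul_three_nodes_le (Finset.univ.erase (0 : Fin (D + 1))) hE.weight
        (fun h => hE.dualEigenvalue h + 1) hw (i₁ := ⟨1, by omega⟩) (i₂ := ⟨2, by omega⟩)
        (i₃ := ⟨D, by omega⟩) (hmem _ _ one_ne_zero) (hmem _ _ (by omega)) (hmem _ _ (by omega))
        (hlt _ _ (Fin.lt_def.2 (by simp))) (hlt _ _ (Fin.lt_def.2 (by simp; omega)))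
        (fun i hi h1 h2 h3 => by
          have h0 := Finset.ne_of_mem_erase hi
          simp only [ne_eq, Fin.ext_iff, Fin.val_zero] at h0 h1 h2 h3
          exact ⟨hlt _ _ (Fin.lt_def.2 (by simp; omega)), hlt _ _ (Fin.lt_def.2 (by simp; omega))⟩)
        hb1pos (mul_pos hc2pos hb2pos) (by linarith) ho
      refine ⟨hle, heq.trans ⟨fun hall => ?_, fun hD2 i hi => ?_⟩⟩
      · by_contra hne
        -- Indices 1 and 2 are already listed, so index 3 is the one that detects D > 3.
        have := hall ⟨3, by omega⟩ (hmem _ _ three_ne_zero)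
        simp only [Fin.ext_iff] at this
        omega
      · have h0 := Finset.ne_of_mem_erase hi
        simp only [ne_eq, Fin.ext_iff, Fin.val_zero] at h0 ⊢
        omega
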